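/- Let $(\Omega,\mathcal F)$ be a measurable space, $p(x,dy)$ a Markov kernel on it and $\pi$ a probability measure with respect to which $p$ is reversible: $\pi(dx)\,p(x,dy)=\pi(dy)\,p(y,dx)$. Let $Pf(x)=\int_\Omega f(y)\,p(x,dy)$ be the associated self-adjoint contraction on the real Hilbert space $L^2(\pi)$; it leaves $L^2_0(\pi)=\{f\in L^2(\pi):\int f\,d\pi=0\}$ invariant, and $\sigma(P)$ denotes the spectrum of $P$ on $L^2_0(\pi)$. Let $p^2$ be the two-step transition kernel and $$k_2=\inf_{A\in\mathcal F,\ 0<\pi(A)<1}\ \frac{1}{\pi(A)\pi(A^c)}\int_A p^2(x,A^c)\,\pi(dx)\ \in[0,\infty]\qquad(\inf\emptyset=\infty).$$ Then the following are equivalent: 1. $P$ has an $L^2$-spectral gap, that is, there is $r>0$ such that $\lim_{n\to\infty}\|P^nf\|_2^{1/n}$ exists and is at most $1-r$ for every $f\in L^2(\pi)$ with $\int f\,d\pi=0$ and $\int f^2\,d\pi=1$; 2. $P$ has a spectral gap both at $1$ and at $-1$, that is, there are $r_1,r_{-1}>0$ with $\sigma(P)\subset[-1,1-r_1]$ and $\sigma(P)\subset[-1+r_{-1},1]$;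 3. $k_2>0$. -/

import Mathlib

open MeasureTheory ProbabilityTheory Filter Topology
open scoped ENNReal

noncomputable section

namespace MarkovGap

variable {Ω : Type*} [MeasurableSpace Ω]

/-- The normalized probability flow
`k_n(A) = (1 / (π(A) π(Aᶜ))) ∫_A p^n(x, Aᶜ) π(dx)`, where the power `p ^ n` in the monoid of
kernels under composition is the `n`-step transition kernel. -/
def isoFlow (p : Kernel Ω Ω) (π : Measure Ω) (n : ℕ) (A : Set Ω) : ℝ≥0∞ :=
  (∫⁻ x in A, (p ^ n) x Aᶜ ∂π) / (π A * π Aᶜ)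

/-- The isoperimetric constant `k_n = inf_A k_n(A)`, over the measurable sets `A` for which
`k_n(A)` makes sense, that is, `0 < π(A) < 1`. (The infimum over the empty family is `∞`.) -/
def isoConst (p : Kernel Ω Ω) (π : Measure Ω) (n : ℕ) : ℝ≥0∞ :=
  ⨅ (A : Set Ω) (_ : MeasurableSet A) (_ : 0 < π A) (_ : π A < 1), isoFlow p π n A

theorem ae_ae {p : Kernel Ω Ω} {π : Measure Ω} (h : p.Invariant π) {q : Ω → Prop}
    (hq : ∀ᵐ y ∂π, q y) : ∀ᵐ x ∂π, ∀ᵐ y ∂(p x), q y := by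
  refine Measure.ae_ae_of_ae_comp (μ := π) (κ := p) ?_
  rw [h.def]
  exact hq

theorem lintegral_kernel {p : Kernel Ω Ω} {π : Measure Ω} (h : p.Invariant π) {g : Ω → ℝ≥0∞}
    (hg : AEMeasurable g π) : ∫⁻ x, ∫⁻ y, g y ∂(p x) ∂π = ∫⁻ y, g y ∂π := by
  rw [← Measure.lintegral_bind p.aemeasurable (by rwa [h.def]), h.def]

theorem aestronglyMeasurable_kernel {p : Kernel Ω Ω} [IsMarkovKernel p] {π : Measure Ω}
    [IsProbabilityMeasure π] (h : p.Invariant π) {f : Ω → ℝ} (hf : AEStronglyMeasurable f π) :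
    AEStronglyMeasurable (fun x => ∫ y, f y ∂(p x)) π := by
  refine ⟨fun x => ∫ y, hf.mk f y ∂(p x), ?_, ?_⟩
  · exact (hf.stronglyMeasurable_mk.comp_measurable measurable_snd).integral_kernel_prod_right'
      (κ := p) (f := fun z : Ω × Ω => hf.mk f z.2)
  · filter_upwards [ae_ae h hf.ae_eq_mk] with x hx using integral_congr_ae hx

theorem eLpNorm_kernel_le {p : Kernel Ω Ω} [IsMarkovKernel p] {π : Measure Ω}
    [IsProbabilityMeasure π] (h : p.Invariant π) {f : Ω → ℝ} (hf : AEStronglyMeasurable f π) :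
    eLpNorm (fun x => ∫ y, f y ∂(p x)) 2 π ≤ eLpNorm f 2 π := by
  have hm : ∀ᵐ x ∂π, AEStronglyMeasurable f (p x) := by
    filter_upwards [ae_ae h hf.ae_eq_mk] with x hx
    exact ⟨hf.mk f, hf.stronglyMeasurable_mk, hx⟩
  have key : ∀ᵐ x ∂π, ‖∫ y, f y ∂(p x)‖ₑ ^ (2 : ℝ) ≤ ∫⁻ y, ‖f y‖ₑ ^ (2 : ℝ) ∂(p x) := by
    filter_upwards [hm] with x hx
    have h1 : ‖∫ y, f y ∂(p x)‖ₑ ≤ eLpNorm f 2 (p x) :=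
      (enorm_integral_le_lintegral_enorm _).trans
        (by rw [← eLpNorm_one_eq_lintegral_enorm]
            exact eLpNorm_le_eLpNorm_of_exponent_le (by norm_num) hx)
    refine (ENNReal.rpow_le_rpow h1 (by norm_num)).trans (le_of_eq ?_)
    rw [eLpNorm_eq_lintegral_rpow_enorm_toReal (by norm_num) (by norm_num), ← ENNReal.rpow_mul]
    norm_num
  rw [eLpNorm_eq_lintegral_rpow_enorm_toReal (by norm_num) (by norm_num),
    eLpNorm_eq_lintegral_rpow_enorm_toReal (by norm_num) (by norm_num)]
  refine ENNReal.rpow_le_rpow ?_ (by norm_num)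
  calc ∫⁻ x, ‖∫ y, f y ∂(p x)‖ₑ ^ (2 : ℝ≥0∞).toReal ∂π
      ≤ ∫⁻ x, ∫⁻ y, ‖f y‖ₑ ^ (2 : ℝ) ∂(p x) ∂π := lintegral_mono_ae (by simpa using key)
    _ = ∫⁻ y, ‖f y‖ₑ ^ (2 : ℝ) ∂π := lintegral_kernel h (hf.enorm.pow_const _)
    _ = ∫⁻ y, ‖f y‖ₑ ^ (2 : ℝ≥0∞).toReal ∂π := by simp

theorem memLp_kernel {p : Kernel Ω Ω} [IsMarkovKernel p] {π : Measure Ω}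
    [IsProbabilityMeasure π] (h : p.Invariant π) {f : Ω → ℝ} (hf : MemLp f 2 π) :
    MemLp (fun x => ∫ y, f y ∂(p x)) 2 π :=
  ⟨aestronglyMeasurable_kernel h hf.1, (eLpNorm_kernel_le h hf.1).trans_lt hf.2⟩

theorem ae_integrable_kernel {p : Kernel Ω Ω} [IsMarkovKernel p] {π : Measure Ω}
    [IsProbabilityMeasure π] (h : p.Invariant π) {f : Ω → ℝ} (hf : MemLp f 2 π) :
    ∀ᵐ x ∂π, Integrable f (p x) := by
  refine Measure.ae_integrable_of_integrable_comp (μ := π) (κ := p) ?_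
  rw [h.def]
  exact hf.integrable (by norm_num)

/-- The operator `P f (x) = ∫ f(y) p(x, dy)` on the Hilbert space `L²(π)`, where `π` is an
invariant probability measure of the Markov kernel `p`. -/
def markovOp (p : Kernel Ω Ω) [IsMarkovKernel p] (π : Measure Ω) [IsProbabilityMeasure π]
    (h : p.Invariant π) : Lp ℝ 2 π →L[ℝ] Lp ℝ 2 π :=
  LinearMap.mkContinuous
    { toFun := fun f => (memLp_kernel h (Lp.memLp f)).toLp (fun x => ∫ y, f y ∂(p x))
      map_add' := fun f g => by
        rw [← MemLp.toLp_add]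
        refine MemLp.toLp_congr _ _ ?_
        filter_upwards [ae_ae h (Lp.coeFn_add f g), ae_integrable_kernel h (Lp.memLp f),
          ae_integrable_kernel h (Lp.memLp g)] with x hx hf hg
        rw [integral_congr_ae hx]
        exact integral_add hf hg
      map_smul' := fun c f => by
        rw [RingHom.id_apply, ← MemLp.toLp_const_smul]
        refine MemLp.toLp_congr _ _ ?_
        filter_upwards [ae_ae h (Lp.coeFn_smul c f)] with x hx
        rw [integral_congr_ae hx]
        exact integral_smul c _ }
    1 (fun f => by
      rw [one_mul]
      change ‖(memLp_kernel h (Lp.memLp f)).toLp _‖ ≤ _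
      rw [Lp.norm_toLp, Lp.norm_def]
      exact ENNReal.toReal_mono (Lp.eLpNorm_ne_top f)
        (eLpNorm_kernel_le h (Lp.aestronglyMeasurable f)))

theorem markovOp_ae_eq (p : Kernel Ω Ω) [IsMarkovKernel p] (π : Measure Ω)
    [IsProbabilityMeasure π] (h : p.Invariant π) (f : Lp ℝ 2 π) :
    markovOp p π h f =ᵐ[π] fun x => ∫ y, f y ∂(p x) :=
  MemLp.coeFn_toLp (memLp_kernel h (Lp.memLp f))

/-- The closed subspace `L²₀(π)` of the functions in `L²(π)` with mean zero. -/
def meanZero (π : Measure Ω) [IsProbabilityMeasure π] : Submodule ℝ (Lp ℝ 2 π) where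
  carrier := {f | ∫ x, f x ∂π = 0}
  zero_mem' := by
    change ∫ x, (0 : Lp ℝ 2 π) x ∂π = 0
    rw [integral_congr_ae (Lp.coeFn_zero ℝ 2 π)]
    simp
  add_mem' := fun {f g} hf hg => by
    change ∫ x, (f + g : Lp ℝ 2 π) x ∂π = 0
    rw [integral_congr_ae (Lp.coeFn_add f g)]
    have hi : ∀ u : Lp ℝ 2 π, Integrable u π := fun u => (Lp.memLp u).integrable (by norm_num)
    refine (integral_add (hi f) (hi g)).trans ?_
    rw [show ∫ x, f x ∂π = 0 from hf, show ∫ x, g x ∂π = 0 from hg, add_zero]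
  smul_mem' := fun c f hf => by
    change ∫ x, (c • f : Lp ℝ 2 π) x ∂π = 0
    rw [integral_congr_ae (Lp.coeFn_smul c f)]
    refine (integral_smul c _).trans ?_
    rw [show ∫ x, f x ∂π = 0 from hf, smul_zero]

theorem markovOp_mem_meanZero (p : Kernel Ω Ω) [IsMarkovKernel p] (π : Measure Ω)
    [IsProbabilityMeasure π] (h : p.Invariant π) (f : Lp ℝ 2 π) (hf : f ∈ meanZero π) :
    markovOp p π h f ∈ meanZero π := by
  change ∫ x, markovOp p π h f x ∂π = 0
  rw [integral_congr_ae (markovOp_ae_eq p π h f)]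
  have hi : Integrable f (p ∘ₘ π) := by
    rw [h.def]; exact (Lp.memLp f).integrable (by norm_num)
  have hc : ∫ x, ∫ y, f y ∂(p x) ∂π = ∫ y, f y ∂((p ∘ₖ Kernel.const Unit π) ()) := by
    rw [Kernel.integral_comp (by rwa [Kernel.comp_const, Kernel.const_apply])]
    simp
  rw [hc, Kernel.comp_const, Kernel.const_apply, h.def]
  exact hf

/-- The operator `P` on `L²₀(π)`. -/
def markovOpZero (p : Kernel Ω Ω) [IsMarkovKernel p] (π : Measure Ω) [IsProbabilityMeasure π]
    (h : p.Invariant π) : meanZero π →L[ℝ] meanZero π :=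
  (markovOp p π h ∘L (meanZero π).subtypeL).codRestrict (meanZero π)
    (fun f => markovOp_mem_meanZero p π h f f.2)

/-- `P` has an `L²`-spectral gap: there is `r > 0` such that
`lim_{n → ∞} ‖P^n f‖₂^{1/n} ≤ 1 - r` (the limit exists and satisfies the bound) for all
`f ∈ L²(π)` with `∫ f dπ = 0` and `∫ f² dπ = 1`. -/
def HasL2SpectralGap (p : Kernel Ω Ω) [IsMarkovKernel p] (π : Measure Ω)
    [IsProbabilityMeasure π] (h : p.Invariant π) : Prop :=
  ∃ r : ℝ, 0 < r ∧ ∀ f : Lp ℝ 2 π, ∫ x, f x ∂π = 0 → ∫ x, f x ^ 2 ∂π = 1 →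
    ∃ l : ℝ, Tendsto (fun n : ℕ => ‖(markovOp p π h ^ n) f‖ ^ (1 / (n : ℝ))) atTop (𝓝 l) ∧
      l ≤ 1 - r

/-- `P` has a spectral gap at `1`: `σ(P) ⊆ [-1, 1 - r]` for some `r > 0`, where `P` acts
on `L²₀(π)`. -/
def HasGapAtOne (p : Kernel Ω Ω) [IsMarkovKernel p] (π : Measure Ω)
    [IsProbabilityMeasure π] (h : p.Invariant π) : Prop :=
  ∃ r : ℝ, 0 < r ∧ spectrum ℝ (markovOpZero p π h) ⊆ Set.Icc (-1) (1 - r)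

/-- `P` has a spectral gap at `-1`: `σ(P) ⊆ [-1 + r, 1]` for some `r > 0`, where `P` acts
on `L²₀(π)`. -/
def HasGapAtNegOne (p : Kernel Ω Ω) [IsMarkovKernel p] (π : Measure Ω)
    [IsProbabilityMeasure π] (h : p.Invariant π) : Prop :=
  ∃ r : ℝ, 0 < r ∧ spectrum ℝ (markovOpZero p π h) ⊆ Set.Icc (-1 + r) 1

end MarkovGap

end

/-! Write `P₀` for `P` on `L²₀(π)`. All three conditions are equivalent to `‖P₀‖ < 1`.

L² gap: for symmetric `T`, `‖Tⁿ⁺¹f‖² = ⟪Tⁿf, Tⁿ⁺²f⟫ ≤ ‖Tⁿf‖ ‖Tⁿ⁺²f‖`, so for a unit vector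
`‖Tⁿf‖^(1/n)` increases in `n ≥ 1`. Its limit thus dominates `‖Tf‖`, and a bound on all the limits
is a bound on the operator norm.

Spectrum: a symmetric operator has `‖T‖` or `-‖T‖` in its spectrum
(`norm_mem_spectrum_or_neg_norm_mem_spectrum`), so the gaps at `1` and `-1` together say `‖P₀‖ < 1`.

Isoperimetry: let `J` be the law of the endpoints of a stationary two-step path. By reversibility `∫
f(x) g(y) dJ = ⟪f, P²g⟫ = ⟪Pf, Pg⟫`; two steps are used because `‖Pf‖²` detects both ends of the
spectrum. Testing on `f = 1_A - π(A)` gives `k₂ ≥ 1 - ‖P₀‖²`. Conversely, the Cheeger inequality of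
Lawler and Sokal (`mul_integral_sq_le`), applied to `∫ (f(x) - f(y))² dJ = 2‖f‖² - 2‖Pf‖²`, bounds
`‖P₀‖` away from `1`. -/

namespace MarkovGap

/-! ### Symmetric operators: growth of iterates, norm and spectrum. -/

section Hilbert

variable {H : Type*} [NormedAddCommGroup H] [InnerProductSpace ℝ H]

/-- The norms of the iterates of a symmetric operator are log-convex. -/
theorem norm_pow_apply_sq_le {T : H →L[ℝ] H} (hT : (T : H →ₗ[ℝ] H).IsSymmetric) (f : H) (n : ℕ) :
    ‖(T ^ (n + 1)) f‖ ^ 2 ≤ ‖(T ^ n) f‖ * ‖(T ^ (n + 2)) f‖ := by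
  have h1 : (T ^ (n + 1)) f = T ((T ^ n) f) := by rw [pow_succ']; rfl
  have h2 : (T ^ (n + 2)) f = T ((T ^ (n + 1)) f) := by rw [pow_succ']; rfl
  have h3 : ‖(T ^ (n + 1)) f‖ ^ 2 = inner ℝ ((T ^ n) f) ((T ^ (n + 2)) f) := by
    rw [← real_inner_self_eq_norm_sq, h2]
    conv_lhs => rw [h1]
    rw [h1]
    exact hT ((T ^ n) f) (T ((T ^ n) f))
  rw [h3]
  exact real_inner_le_norm _ _

/-- Induction: raise the log-convexity inequality to the power `n + 1`, bound `a n ^ (n + 1)` by the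
previous case, and cancel `a (n + 1) ^ n`. -/
theorem pow_succ_le_pow_of_sq_le_mul {a : ℕ → ℝ} (h0 : a 0 = 1) (hnn : ∀ n, 0 ≤ a n)
    (h : ∀ n, a (n + 1) ^ 2 ≤ a n * a (n + 2)) (n : ℕ) : a n ^ (n + 1) ≤ a (n + 1) ^ n := by
  induction n with
  | zero => simp [h0]
  | succ n ih =>
    rcases (hnn (n + 1)).eq_or_lt with h' | h'
    · rw [← h', zero_pow (by omega)]
      exact pow_nonneg (hnn _) _
    · have h1 : a (n + 1) ^ n * a (n + 1) ^ (n + 2) ≤ a (n + 1) ^ n * a (n + 2) ^ (n + 1) :=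
        calc a (n + 1) ^ n * a (n + 1) ^ (n + 2) = (a (n + 1) ^ 2) ^ (n + 1) := by ring
          _ ≤ (a n * a (n + 2)) ^ (n + 1) := pow_le_pow_left₀ (by positivity) (h n) _
          _ = a n ^ (n + 1) * a (n + 2) ^ (n + 1) := by ring
          _ ≤ _ := mul_le_mul_of_nonneg_right ih (pow_nonneg (hnn _) _)
      exact le_of_mul_le_mul_left h1 (pow_pos h' n)

/-- The index starts at `1`: at `n = 0` the exponent `1 / 0` is `0` by convention, and that term
carries no information. -/
theorem monotone_root_of_sq_le_mul {a : ℕ → ℝ} (h0 : a 0 = 1) (hnn : ∀ n, 0 ≤ a n)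
    (h : ∀ n, a (n + 1) ^ 2 ≤ a n * a (n + 2)) :
    Monotone fun n : ℕ => a (n + 1) ^ (1 / ((n + 1 : ℕ) : ℝ)) := by
  refine monotone_nat_of_le_succ fun n => ?_
  have h1 := pow_succ_le_pow_of_sq_le_mul h0 hnn h (n + 1)
  have hp : ∀ m k : ℕ, m ≠ 0 → ((a m) ^ (1 / (m : ℝ))) ^ (m * k) = a m ^ k := fun m k hm => by
    rw [pow_mul, one_div, Real.rpow_inv_natCast_pow (hnn m) hm]
  refine le_of_pow_le_pow_left₀ (n := (n + 1) * (n + 2)) (by positivity)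
    (Real.rpow_nonneg (hnn _) _) ?_
  rw [hp _ _ (by omega), mul_comm, hp _ _ (by omega)]
  exact h1

theorem norm_pow_apply_root_le {T : H →L[ℝ] H} {f : H} {c : ℝ} (hc : 0 ≤ c)
    (h : ∀ n, ‖(T ^ n) f‖ ≤ c ^ n) (n : ℕ) :
    ‖(T ^ (n + 1)) f‖ ^ (1 / ((n + 1 : ℕ) : ℝ)) ≤ c := by
  refine (Real.rpow_le_rpow (norm_nonneg _) (h (n + 1)) (by positivity)).trans_eq ?_
  rw [one_div, Real.pow_rpow_inv_natCast hc (by omega)]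

/-- For a symmetric operator that contracts the iterates of a unit vector by `c`, the limit of
`‖T ^ n f‖ ^ (1 / n)` exists and is at most `c`. -/
theorem exists_tendsto_norm_pow_root {T : H →L[ℝ] H} (hT : (T : H →ₗ[ℝ] H).IsSymmetric) {f : H}
    (hf : ‖f‖ = 1) {c : ℝ} (hc : 0 ≤ c) (h : ∀ n, ‖(T ^ n) f‖ ≤ c ^ n) :
    ∃ l : ℝ, Tendsto (fun n : ℕ => ‖(T ^ n) f‖ ^ (1 / (n : ℝ))) atTop (𝓝 l) ∧ l ≤ c := by
  have hb := norm_pow_apply_root_le hc h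
  have hm := monotone_root_of_sq_le_mul (a := fun n => ‖(T ^ n) f‖) (by simpa using hf)
    (fun _ => norm_nonneg _) (norm_pow_apply_sq_le hT f)
  have ht := tendsto_atTop_ciSup hm ⟨c, by rintro _ ⟨n, rfl⟩; exact hb n⟩
  exact ⟨_, (tendsto_add_atTop_iff_nat (f := fun n : ℕ => ‖(T ^ n) f‖ ^ (1 / (n : ℝ))) 1).1 ht,
    ciSup_le hb⟩

/-- The first term of an increasing sequence is at most its limit, so asymptotic decay already
controls a single step. -/
theorem norm_apply_le_of_tendsto_norm_pow_root {T : H →L[ℝ] H}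
    (hT : (T : H →ₗ[ℝ] H).IsSymmetric) {f : H} (hf : ‖f‖ = 1) {l : ℝ}
    (h : Tendsto (fun n : ℕ => ‖(T ^ n) f‖ ^ (1 / (n : ℝ))) atTop (𝓝 l)) : ‖T f‖ ≤ l := by
  have hm := monotone_root_of_sq_le_mul (a := fun n => ‖(T ^ n) f‖) (by simpa using hf)
    (fun _ => norm_nonneg _) (norm_pow_apply_sq_le hT f)
  have := hm.ge_of_tendsto
    ((tendsto_add_atTop_iff_nat (f := fun n : ℕ => ‖(T ^ n) f‖ ^ (1 / (n : ℝ))) 1).2 h) 0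
  simpa using this

/-- The norm of a symmetric operator is attained, up to sign, on its spectrum. -/
theorem norm_mem_spectrum_or_neg_norm_mem_spectrum [Nontrivial H] {T : H →L[ℝ] H}
    (hT : (T : H →ₗ[ℝ] H).IsSymmetric) : ‖T‖ ∈ spectrum ℝ T ∨ -‖T‖ ∈ spectrum ℝ T := by
  by_contra! hcon
  obtain ⟨h1, h2⟩ := hcon
  rw [spectrum.notMem_iff] at h1 h2
  set c := ‖T‖ with hc
  have hc0 : 0 ≤ c := norm_nonneg T
  -- The unit `u` is `(c - T)(-c - T) = T² - c²`.
  obtain ⟨u, hu⟩ := h1.mul h2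
  have happ : ∀ x, (u : H →L[ℝ] H) x = T (T x) - c ^ 2 • x := fun x => by
    rw [hu]
    simp only [Algebra.algebraMap_eq_smul_one, mul_apply_eq_comp,
      sub_apply, smul_apply,
      one_apply_eq_self, map_sub, map_smul]
    module
  set K := ‖((u⁻¹ : (H →L[ℝ] H)ˣ) : H →L[ℝ] H)‖ with hK
  have hK0 : 0 ≤ K := norm_nonneg _
  have hinv : ∀ x, ‖x‖ ≤ K * ‖(u : H →L[ℝ] H) x‖ := fun x => by
    have : ((u⁻¹ : (H →L[ℝ] H)ˣ) : H →L[ℝ] H) ((u : H →L[ℝ] H) x) = x := by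
      rw [← mul_apply_eq_comp, ← Units.val_mul, inv_mul_cancel]; rfl
    calc ‖x‖ = ‖((u⁻¹ : (H →L[ℝ] H)ˣ) : H →L[ℝ] H) ((u : H →L[ℝ] H) x)‖ := by rw [this]
      _ ≤ _ := ContinuousLinearMap.le_opNorm _ _
  -- Expand `‖T²x - c²x‖²`, using `⟪T²x, x⟫ = ‖Tx‖²` and `‖T²x‖ ≤ c‖Tx‖`.
  have hsq : ∀ x, ‖(u : H →L[ℝ] H) x‖ ^ 2 ≤ c ^ 2 * (c ^ 2 * ‖x‖ ^ 2 - ‖T x‖ ^ 2) := fun x => by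
    have e1 : inner ℝ (T (T x)) x = ‖T x‖ ^ 2 := by
      rw [← real_inner_self_eq_norm_sq]; exact hT (T x) x
    have e2 : ‖T (T x)‖ ^ 2 ≤ (c * ‖T x‖) ^ 2 :=
      pow_le_pow_left₀ (norm_nonneg _) (T.le_opNorm _) 2
    rw [happ, norm_sub_sq_real, inner_smul_right, e1, norm_smul, Real.norm_eq_abs,
      abs_of_nonneg (sq_nonneg c)]
    nlinarith
  have hsq' : ∀ x, ‖x‖ ^ 2 ≤ K ^ 2 * (c ^ 2 * (c ^ 2 * ‖x‖ ^ 2 - ‖T x‖ ^ 2)) := fun x =>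
    calc ‖x‖ ^ 2 ≤ (K * ‖(u : H →L[ℝ] H) x‖) ^ 2 :=
          pow_le_pow_left₀ (norm_nonneg _) (hinv x) 2
      _ = K ^ 2 * ‖(u : H →L[ℝ] H) x‖ ^ 2 := by ring
      _ ≤ _ := mul_le_mul_of_nonneg_left (hsq x) (sq_nonneg K)
  obtain ⟨x₀, hx₀⟩ := exists_ne (0 : H)
  have hx₀' : 0 < ‖x₀‖ ^ 2 := by positivity
  have hM : 0 < K ^ 2 * c ^ 2 := by
    by_contra hM
    have hM' : K ^ 2 * c ^ 2 = 0 := le_antisymm (not_lt.1 hM) (by positivity)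
    have := hsq' x₀
    rw [← mul_assoc, hM', zero_mul] at this
    linarith
  set M := K ^ 2 * c ^ 2 with hMdef
  -- Invertibility of `u` makes `c²‖x‖² - ‖Tx‖²` at least `‖x‖² / M`, so `T` would have norm
  -- strictly below `c`.
  have hT' : ∀ x, ‖T x‖ ^ 2 ≤ (c ^ 2 - 1 / M) * ‖x‖ ^ 2 := fun x => by
    have h3 := hsq' x
    rw [← mul_assoc, ← hMdef] at h3
    have h4 : ‖x‖ ^ 2 / M ≤ c ^ 2 * ‖x‖ ^ 2 - ‖T x‖ ^ 2 := by
      rw [div_le_iff₀ hM]; linarith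
    have h5 : (c ^ 2 - 1 / M) * ‖x‖ ^ 2 = c ^ 2 * ‖x‖ ^ 2 - ‖x‖ ^ 2 / M := by ring
    linarith
  have hd : 0 ≤ c ^ 2 - 1 / M := by
    by_contra hd
    have := hT' x₀
    nlinarith [sq_nonneg ‖T x₀‖]
  have hle : c ≤ √(c ^ 2 - 1 / M) := T.opNorm_le_bound (Real.sqrt_nonneg _) fun x => by
    refine le_of_sq_le_sq ?_ (by positivity)
    rw [mul_pow, Real.sq_sqrt hd]
    exact hT' x
  have : c ^ 2 ≤ c ^ 2 - 1 / M := (Real.le_sqrt hc0 hd).1 hle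
  have : 0 < 1 / M := by positivity
  linarith

theorem norm_lt_one_iff_spectrum [CompleteSpace H] {T : H →L[ℝ] H}
    (hT : (T : H →ₗ[ℝ] H).IsSymmetric) :
    ‖T‖ < 1 ↔ (∃ r : ℝ, 0 < r ∧ spectrum ℝ T ⊆ Set.Icc (-1) (1 - r)) ∧
      (∃ r : ℝ, 0 < r ∧ spectrum ℝ T ⊆ Set.Icc (-1 + r) 1) := by
  constructor
  · intro h
    have hs : ∀ x ∈ spectrum ℝ T, -‖T‖ ≤ x ∧ x ≤ ‖T‖ := fun x hx => by
      rcases subsingleton_or_nontrivial H with hH | hH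
      · rw [spectrum.of_subsingleton] at hx
        exact hx.elim
      · exact abs_le.1 (spectrum.norm_le_norm_of_mem hx)
    exact ⟨⟨1 - ‖T‖, by linarith, fun x hx => ⟨by linarith [hs x hx], by linarith [hs x hx]⟩⟩,
      ⟨1 - ‖T‖, by linarith, fun x hx => ⟨by linarith [hs x hx], by linarith [hs x hx]⟩⟩⟩
  · rintro ⟨⟨r, hr, h⟩, ⟨s, hs, h'⟩⟩
    rcases subsingleton_or_nontrivial H with hH | hH
    · rw [Subsingleton.elim T 0, norm_zero]
      exact one_pos
    · rcases norm_mem_spectrum_or_neg_norm_mem_spectrum hT with hm | hm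
      · linarith [(h hm).2]
      · linarith [(h' hm).1]

end Hilbert

/-! ### Medians, the coarea formula and Cheeger's inequality. -/

section Cheeger

variable {Ω : Type*} [MeasurableSpace Ω]

/-- A median of a measurable function. -/
theorem exists_median (π : Measure Ω) [IsProbabilityMeasure π] {f : Ω → ℝ} (hf : Measurable f) :
    ∃ m : ℝ, π {x | m < f x} ≤ 1 / 2 ∧ π {x | f x < m} ≤ 1 / 2 := by
  have hhalf : (0 : ℝ≥0∞) < 1 / 2 := by simp
  set S : Set ℝ := {t | π {x | t < f x} ≤ 1 / 2} with hS
  have hup : IsUpperSet S := fun s t hst hs =>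
    (measure_mono fun x (hx : t < f x) => hst.trans_lt hx).trans hs
  have hge : ∀ t, t ∉ S → π {x | f x ≤ t} ≤ 1 / 2 := fun t ht => by
    have hc : {x | f x ≤ t} = {x | t < f x}ᶜ := by ext; simp
    have hms : MeasurableSet {x | t < f x} := measurableSet_lt measurable_const hf
    rw [hc, prob_compl_eq_one_sub hms]
    have h2 : (1 : ℝ≥0∞) / 2 = 1 - 1 / 2 := by
      rw [one_div, ENNReal.one_sub_inv_two]
    rw [h2]
    exact tsub_le_tsub_left (not_le.1 ht).le 1
  have hne : S.Nonempty := by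
    have hanti : Antitone fun n : ℕ => {x | (n : ℝ) < f x} := fun a b hab x (hx : (b : ℝ) < f x) =>
      show (a : ℝ) < f x from (Nat.cast_le.2 hab).trans_lt hx
    have ht := tendsto_measure_iInter_atTop (μ := π) (s := fun n : ℕ => {x | (n : ℝ) < f x})
      (fun n => (measurableSet_lt measurable_const hf).nullMeasurableSet) hanti
      ⟨0, measure_ne_top _ _⟩
    have he : (⋂ n : ℕ, {x | (n : ℝ) < f x}) = ∅ := by
      ext x
      obtain ⟨n, hn⟩ := exists_nat_ge (f x)
      simpa using ⟨n, hn⟩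
    rw [he, measure_empty] at ht
    obtain ⟨n, hn⟩ := (ht.eventually (gt_mem_nhds hhalf)).exists
    exact ⟨n, hn.le⟩
  have hbdd : BddBelow S := by
    have hanti : Antitone fun n : ℕ => {x | f x ≤ -(n : ℝ)} := fun a b hab x (hx : f x ≤ -(b : ℝ)) =>
      show f x ≤ -(a : ℝ) from hx.trans (neg_le_neg (Nat.cast_le.2 hab))
    have ht := tendsto_measure_iInter_atTop (μ := π) (s := fun n : ℕ => {x | f x ≤ -(n : ℝ)})
      (fun n => (measurableSet_le hf measurable_const).nullMeasurableSet) hanti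
      ⟨0, measure_ne_top _ _⟩
    have he : (⋂ n : ℕ, {x | f x ≤ -(n : ℝ)}) = ∅ := by
      ext x
      obtain ⟨n, hn⟩ := exists_nat_gt (-f x)
      simpa using ⟨n, by linarith⟩
    rw [he, measure_empty] at ht
    obtain ⟨n, hn⟩ := (ht.eventually (gt_mem_nhds hhalf)).exists
    refine ⟨-(n : ℝ), fun t ht => ?_⟩
    by_contra! hlt
    have h1 : π {x | -(n : ℝ) < f x} ≤ 1 / 2 := hup hlt.le ht
    have h2 : π Set.univ ≤ π {x | -(n : ℝ) < f x} + π {x | f x ≤ -(n : ℝ)} :=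
      (measure_mono fun x _ => show x ∈ {x | -(n : ℝ) < f x} ∪ {x | f x ≤ -(n : ℝ)} from
        lt_or_ge (-(n : ℝ)) (f x)).trans (measure_union_le _ _)
    rw [measure_univ] at h2
    have h3 : π {x | -(n : ℝ) < f x} + π {x | f x ≤ -(n : ℝ)} < 1 / 2 + 1 / 2 :=
      ENNReal.add_lt_add_of_le_of_lt (measure_ne_top _ _) h1 hn
    rw [ENNReal.add_halves] at h3
    exact absurd h2 (not_le.2 h3)
  -- The infimum of the levels whose upper tail is at most `1/2` is a median: each strict tail there
  -- is an increasing union of tails at nearby levels, approached from above or from below.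
  obtain ⟨u, hu_anti, hu_gt, hu⟩ := exists_seq_strictAnti_tendsto (sInf S)
  obtain ⟨v, hv_mono, hv_lt, hv⟩ := exists_seq_strictMono_tendsto (sInf S)
  refine ⟨sInf S, ?_, ?_⟩
  · have he : {x | sInf S < f x} = ⋃ n, {x | u n < f x} := by
      ext x
      simp only [Set.mem_ofPred_eq, Set.mem_iUnion]
      exact ⟨fun h => (hu.eventually (gt_mem_nhds h)).exists, fun ⟨n, hn⟩ => (hu_gt n).trans hn⟩
    have hm : Monotone fun n => {x | u n < f x} := fun a b hab x hx =>
      (hu_anti.antitone hab).trans_lt hx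
    rw [he, hm.measure_iUnion]
    refine iSup_le fun n => ?_
    obtain ⟨t, ht, htn⟩ := exists_lt_of_csInf_lt hne (hu_gt n)
    exact hup htn.le ht
  · have he : {x | f x < sInf S} = ⋃ n, {x | f x ≤ v n} := by
      ext x
      simp only [Set.mem_ofPred_eq, Set.mem_iUnion]
      exact ⟨fun h => ((hv.eventually (lt_mem_nhds h)).exists).imp fun _ => le_of_lt,
        fun ⟨n, hn⟩ => hn.trans_lt (hv_lt n)⟩
    have hm : Monotone fun n => {x | f x ≤ v n} := fun a b hab x hx =>
      le_trans hx (hv_mono.monotone hab)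
    rw [he, hm.measure_iUnion]
    exact iSup_le fun n => hge _ (notMem_of_lt_csInf (hv_lt n) hbdd)

/-- The positive part of `a - b` is the length of `[b, a)`; since `0 ≤ b`, restricting to positive
levels loses at most a point. -/
theorem ofReal_sub_eq_lintegral_indicator (a b : ℝ) (hb : 0 ≤ b) :
    ENNReal.ofReal (a - b) = ∫⁻ t in Set.Ioi (0 : ℝ), (Set.Ico b a).indicator 1 t := by
  rw [lintegral_indicator_one measurableSet_Ico, Measure.restrict_apply measurableSet_Ico]
  rcases hb.eq_or_lt with rfl | hb
  · have : Set.Ico 0 a ∩ Set.Ioi 0 = Set.Ioo 0 a := by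
      ext; simp only [Set.mem_inter_iff, Set.mem_Ico, Set.mem_Ioi, Set.mem_Ioo]; grind
    rw [this, Real.volume_Ioo]
  · have : Set.Ico b a ∩ Set.Ioi 0 = Set.Ico b a :=
      Set.inter_eq_left.2 fun x hx => hb.trans_le hx.1
    rw [this, Real.volume_Ico]

/-- The coarea formula for a measure on a product. -/
theorem lintegral_ofReal_sub_eq (J : Measure (Ω × Ω)) [SFinite J] {h : Ω → ℝ} (hm : Measurable h)
    (h0 : ∀ x, 0 ≤ h x) :
    ∫⁻ z, ENNReal.ofReal (h z.1 - h z.2) ∂J =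
      ∫⁻ t in Set.Ioi (0 : ℝ), J ({x | t < h x} ×ˢ {x | t < h x}ᶜ) := by
  simp_rw [fun z : Ω × Ω => ofReal_sub_eq_lintegral_indicator (h z.1) (h z.2) (h0 _)]
  have hs1 : MeasurableSet {w : (Ω × Ω) × ℝ | h w.1.2 ≤ w.2} :=
    measurableSet_le (by fun_prop) (by fun_prop)
  have hs2 : MeasurableSet {w : (Ω × Ω) × ℝ | w.2 < h w.1.1} :=
    measurableSet_lt (by fun_prop) (by fun_prop)
  rw [lintegral_lintegral_swap]
  · refine lintegral_congr fun t => ?_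
    have hst : MeasurableSet {x | t < h x} := measurableSet_lt measurable_const hm
    rw [← lintegral_indicator_one (hst.prod hst.compl)]
    refine lintegral_congr fun z => ?_
    simp only [Set.indicator_apply, Set.mem_Ico, Set.mem_prod, Set.mem_ofPred_eq, Set.mem_compl_iff,
      not_lt, Pi.one_apply, and_comm]
  · exact (Measurable.indicator measurable_one (hs1.inter hs2)).aemeasurable

/-- Cheeger's inequality in `L¹`, for functions supported on at most half of the space. -/
theorem half_mul_lintegral_le (π : Measure Ω) [IsProbabilityMeasure π] (J : Measure (Ω × Ω))
    [SFinite J] {κ : ℝ≥0∞}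
    (hJ : ∀ A, MeasurableSet A → κ * (π A * π Aᶜ) ≤ J (A ×ˢ Aᶜ))
    {h : Ω → ℝ} (hm : Measurable h) (h0 : ∀ x, 0 ≤ h x) (hhalf : π {x | 0 < h x} ≤ 1 / 2) :
    κ / 2 * ∫⁻ x, ENNReal.ofReal (h x) ∂π ≤ ∫⁻ z, ENNReal.ofReal (h z.1 - h z.2) ∂J := by
  have hmeas : Measurable fun t : ℝ => π {x | t < h x} := Antitone.measurable fun s t hst =>
    measure_mono fun x (hx : t < h x) => show s < h x from hst.trans_lt hx
  rw [lintegral_ofReal_sub_eq J hm h0,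
    lintegral_eq_lintegral_meas_lt π (Eventually.of_forall h0) hm.aemeasurable,
    ← lintegral_const_mul _ hmeas]
  refine setLIntegral_mono' measurableSet_Ioi fun t ht => ?_
  have hst : MeasurableSet {x | t < h x} := measurableSet_lt measurable_const hm
  refine le_trans ?_ (hJ _ hst)
  have hle : π {x | t < h x} ≤ 1 / 2 :=
    (measure_mono fun x (hx : t < h x) => lt_trans ht hx).trans hhalf
  -- Every positive level set has mass at most `1/2`, so its complement costs only a factor `2` in
  -- the isoperimetric bound.
  have hge : 1 / 2 ≤ π {x | t < h x}ᶜ := by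
    rw [prob_compl_eq_one_sub hst]
    have h2 : (1 : ℝ≥0∞) / 2 = 1 - 1 / 2 := by rw [one_div, ENNReal.one_sub_inv_two]
    rw [h2]
    exact tsub_le_tsub_left hle 1
  calc κ / 2 * π {x | t < h x} = κ * (π {x | t < h x} * (1 / 2)) := by
        rw [div_eq_mul_inv, one_div]; ring
    _ ≤ _ := by gcongr

theorem integral_comp_measurePreserving {α : Type*} [MeasurableSpace α] {J : Measure α}
    {π : Measure Ω} {φ : α → Ω} (hφ : MeasurePreserving φ J π) {g : Ω → ℝ}
    (hg : AEStronglyMeasurable g π) : ∫ z, g (φ z) ∂J = ∫ x, g x ∂π := by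
  rw [← hφ.map_eq, integral_map hφ.aemeasurable (by rwa [hφ.map_eq])]

theorem integrable_sub_sq {π : Measure Ω} {J : Measure (Ω × Ω)} (h1 : MeasurePreserving Prod.fst J π)
    (h2 : MeasurePreserving Prod.snd J π) {u : Ω → ℝ} (hu : MemLp u 2 π) :
    Integrable (fun z : Ω × Ω => (u z.1 - u z.2) ^ 2) J :=
  ((hu.comp_measurePreserving h1).sub (hu.comp_measurePreserving h2)).integrable_sq

/-- Cheeger's inequality for nonnegative functions supported on at most half of the space. -/
theorem mul_integral_sq_le_of_half (π : Measure Ω) [IsProbabilityMeasure π] (J : Measure (Ω × Ω))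
    [SFinite J] (h1 : MeasurePreserving Prod.fst J π) (h2 : MeasurePreserving Prod.snd J π)
    {κ : ℝ} (hκ : 0 < κ)
    (hJ : ∀ A, MeasurableSet A → ENNReal.ofReal κ * (π A * π Aᶜ) ≤ J (A ×ˢ Aᶜ))
    {u : Ω → ℝ} (hm : Measurable u) (h0 : ∀ x, 0 ≤ u x) (hhalf : π {x | 0 < u x} ≤ 1 / 2)
    (hu : MemLp u 2 π) :
    κ ^ 2 / 16 * ∫ x, u x ^ 2 ∂π ≤ ∫ z, (u z.1 - u z.2) ^ 2 ∂J := by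
  have hi := hu.integrable_sq
  have hiE := integrable_sub_sq h1 h2 hu
  have hi1 : Integrable (fun z : Ω × Ω => u z.1 ^ 2) J := h1.integrable_comp_of_integrable hi
  have hi2 : Integrable (fun z : Ω × Ω => u z.2 ^ 2) J := h2.integrable_comp_of_integrable hi
  have hi12 : Integrable (fun z : Ω × Ω => u z.1 ^ 2 + u z.2 ^ 2) J := hi1.add hi2
  have e1 : ∫ z, u z.1 ^ 2 ∂J = ∫ x, u x ^ 2 ∂π :=
    integral_comp_measurePreserving h1 hi.aestronglyMeasurable
  have e2 : ∫ z, u z.2 ^ 2 ∂J = ∫ x, u x ^ 2 ∂π :=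
    integral_comp_measurePreserving h2 hi.aestronglyMeasurable
  -- The `L¹` inequality is applied to `u²`.
  have key := half_mul_lintegral_le π J hJ (hm.pow_const 2) (fun x => sq_nonneg _)
    (h := fun x => u x ^ 2)
    (by simpa only [pow_pos_iff (n := 2) two_ne_zero, sq_pos_iff, fun x => (h0 x).lt_iff_ne']
          using hhalf)
  have hiB : Integrable (fun z : Ω × Ω =>
      4 / κ * (u z.1 - u z.2) ^ 2 + κ / 8 * (u z.1 ^ 2 + u z.2 ^ 2)) J :=
    (hiE.const_mul _).add (hi12.const_mul _)
  -- Weighted AM-GM on `(u z.1 - u z.2)(u z.1 + u z.2)`, then `(a + b)² ≤ 2(a² + b²)`. The weight is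
  -- chosen so that the last term integrates to `κ/4 ∫ u²`, half of the left side of `key`, and can
  -- be absorbed.
  have hpt : ∀ z : Ω × Ω, u z.1 ^ 2 - u z.2 ^ 2 ≤
      4 / κ * (u z.1 - u z.2) ^ 2 + κ / 8 * (u z.1 ^ 2 + u z.2 ^ 2) := fun z => by
    have h3 : 0 ≤ 1 / (16 * κ) * (8 * (u z.1 - u z.2) - κ * (u z.1 + u z.2)) ^ 2 := by positivity
    have h4 : 1 / (16 * κ) * (8 * (u z.1 - u z.2) - κ * (u z.1 + u z.2)) ^ 2 =
        4 / κ * (u z.1 - u z.2) ^ 2 - (u z.1 ^ 2 - u z.2 ^ 2)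
          + κ / 16 * (u z.1 + u z.2) ^ 2 := by
      field_simp
      ring
    nlinarith [mul_nonneg hκ.le (sq_nonneg (u z.1 - u z.2))]
  have hB0 : ∀ z : Ω × Ω,
      0 ≤ 4 / κ * (u z.1 - u z.2) ^ 2 + κ / 8 * (u z.1 ^ 2 + u z.2 ^ 2) := fun z => by positivity
  have key2 : ENNReal.ofReal (κ / 2 * ∫ x, u x ^ 2 ∂π) ≤ ENNReal.ofReal
      (∫ z, (4 / κ * (u z.1 - u z.2) ^ 2 + κ / 8 * (u z.1 ^ 2 + u z.2 ^ 2)) ∂J) := by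
    rw [ofReal_integral_eq_lintegral_ofReal hiB (Eventually.of_forall hB0),
      ENNReal.ofReal_mul (by positivity), ENNReal.ofReal_div_of_pos two_pos,
      ofReal_integral_eq_lintegral_ofReal hi (Eventually.of_forall fun _ => sq_nonneg _),
      ENNReal.ofReal_ofNat]
    exact key.trans (lintegral_mono fun z => ENNReal.ofReal_le_ofReal (hpt z))
  have key3 := (ENNReal.ofReal_le_ofReal_iff (integral_nonneg hB0)).1 key2
  rw [integral_add (hiE.const_mul _) (hi12.const_mul _), integral_const_mul,
    integral_const_mul, integral_add hi1 hi2, e1, e2] at key3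
  have h5 : κ / 4 * ∫ x, u x ^ 2 ∂π ≤ 4 / κ * ∫ z, (u z.1 - u z.2) ^ 2 ∂J := by linarith
  have h6 := mul_le_mul_of_nonneg_left h5 (by positivity : 0 ≤ κ / 4)
  calc κ ^ 2 / 16 * ∫ x, u x ^ 2 ∂π = κ / 4 * (κ / 4 * ∫ x, u x ^ 2 ∂π) := by ring
    _ ≤ _ := h6
    _ = _ := by field_simp

/-- Cheeger's inequality (Lawler and Sokal), for a measure `J` on the product with both marginals
equal to `π`. -/
theorem mul_integral_sq_le (π : Measure Ω) [IsProbabilityMeasure π] (J : Measure (Ω × Ω))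
    [SFinite J] (h1 : MeasurePreserving Prod.fst J π) (h2 : MeasurePreserving Prod.snd J π)
    {κ : ℝ} (hκ : 0 < κ)
    (hJ : ∀ A, MeasurableSet A → ENNReal.ofReal κ * (π A * π Aᶜ) ≤ J (A ×ˢ Aᶜ))
    {f : Ω → ℝ} (hm : Measurable f) (hf : MemLp f 2 π) (hf0 : ∫ x, f x ∂π = 0) :
    κ ^ 2 / 16 * ∫ x, f x ^ 2 ∂π ≤ ∫ z, (f z.1 - f z.2) ^ 2 ∂J := by
  obtain ⟨m, hm1, hm2⟩ := exists_median π hm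
  have hg : MemLp (fun x => f x - m) 2 π := hf.sub (memLp_const m)
  set u : Ω → ℝ := fun x => max (f x - m) 0
  set v : Ω → ℝ := fun x => max (-(f x - m)) 0
  have hu : MemLp u 2 π := hg.pos_part
  have hv : MemLp v 2 π := hg.neg_part
  have key1 := mul_integral_sq_le_of_half π J h1 h2 hκ hJ (u := u)
    ((hm.sub_const m).max measurable_const) (fun x => le_max_right _ _) (by simpa [u] using hm1) hu
  have key2 := mul_integral_sq_le_of_half π J h1 h2 hκ hJ (u := v)
    ((hm.sub_const m).neg.max measurable_const) (fun x => le_max_right _ _)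
    (by simpa [v] using hm2) hv
  -- With `u`, `v` the positive and negative parts of `f - m`, the two sides agree pointwise when `f
  -- - m` has the same sign at both points; for opposite signs a nonnegative cross term is dropped.
  have hE : ∫ z, (u z.1 - u z.2) ^ 2 ∂J + ∫ z, (v z.1 - v z.2) ^ 2 ∂J ≤
      ∫ z, (f z.1 - f z.2) ^ 2 ∂J := by
    rw [← integral_add (integrable_sub_sq h1 h2 hu) (integrable_sub_sq h1 h2 hv)]
    refine integral_mono ((integrable_sub_sq h1 h2 hu).add (integrable_sub_sq h1 h2 hv))
      (integrable_sub_sq h1 h2 hf) fun z => ?_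
    simp only [u, v]
    rcases le_total (f z.1 - m) 0 with ha | ha <;> rcases le_total (f z.2 - m) 0 with hb | hb <;>
      simp only [ha, hb, max_eq_left, max_eq_right, neg_nonneg, Left.neg_nonpos_iff]
    · nlinarith
    · nlinarith [mul_nonneg (neg_nonneg.2 ha) hb]
    · nlinarith [mul_nonneg ha (neg_nonneg.2 hb)]
    · nlinarith
  -- The sum is `(f - m)²`; its cross term integrates to zero since `f` has mean zero.
  have hN : ∫ x, u x ^ 2 ∂π + ∫ x, v x ^ 2 ∂π = ∫ x, f x ^ 2 ∂π + m ^ 2 := by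
    rw [← integral_add hu.integrable_sq hv.integrable_sq]
    have hpt : ∀ x, u x ^ 2 + v x ^ 2 = f x ^ 2 - 2 * m * f x + m ^ 2 := fun x => by
      simp only [u, v]
      rcases le_total (f x - m) 0 with ha | ha <;>
        simp only [ha, max_eq_left, max_eq_right, neg_nonneg, Left.neg_nonpos_iff] <;> ring
    have hif : Integrable (fun x => 2 * m * f x) π := (hf.integrable (by norm_num)).const_mul _
    have hifs : Integrable (fun x => f x ^ 2 - 2 * m * f x) π := hf.integrable_sq.sub hif
    simp_rw [hpt]
    rw [integral_add hifs (integrable_const _), integral_sub hf.integrable_sq hif, integral_const_mul, hf0]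
    simp
  have h3 : 0 ≤ κ ^ 2 / 16 * m ^ 2 := by positivity
  calc κ ^ 2 / 16 * ∫ x, f x ^ 2 ∂π
      ≤ κ ^ 2 / 16 * (∫ x, f x ^ 2 ∂π + m ^ 2) := by rw [mul_add]; linarith
    _ = κ ^ 2 / 16 * ∫ x, u x ^ 2 ∂π + κ ^ 2 / 16 * ∫ x, v x ^ 2 ∂π := by rw [← hN, mul_add]
    _ ≤ _ := (add_le_add key1 key2).trans hE

end Cheeger

/-! ### The Markov operator, the two-step flow and the equivalences. -/

section Kernel

variable {Ω : Type*} [MeasurableSpace Ω] {p : Kernel Ω Ω} [IsMarkovKernel p] {π : Measure Ω}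
  [IsProbabilityMeasure π]

theorem measurePreserving_fst_compProd (p : Kernel Ω Ω) [IsMarkovKernel p] (π : Measure Ω)
    [IsProbabilityMeasure π] : MeasurePreserving Prod.fst (π ⊗ₘ p) π :=
  ⟨measurable_fst, Measure.fst_compProd π p⟩

theorem measurePreserving_snd_compProd (h : p.Invariant π) :
    MeasurePreserving Prod.snd (π ⊗ₘ p) π :=
  ⟨measurable_snd, (Measure.snd_compProd π p).trans h.def⟩

theorem integrable_mul_compProd (h : p.Invariant π) {f g : Ω → ℝ} (hf : MemLp f 2 π)
    (hg : MemLp g 2 π) : Integrable (fun z : Ω × Ω => f z.1 * g z.2) (π ⊗ₘ p) :=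
  (hf.comp_measurePreserving (measurePreserving_fst_compProd p π)).integrable_mul
    (hg.comp_measurePreserving (measurePreserving_snd_compProd h))

omit [IsProbabilityMeasure π] in
theorem inner_eq_integral_mul (f g : Lp ℝ 2 π) : inner ℝ f g = ∫ x, f x * g x ∂π := by
  rw [L2.inner_def]
  simp [mul_comm]

omit [IsProbabilityMeasure π] in
theorem norm_sq_eq_integral (f : Lp ℝ 2 π) : ‖f‖ ^ 2 = ∫ x, f x ^ 2 ∂π := by
  rw [← real_inner_self_eq_norm_sq, inner_eq_integral_mul]
  simp_rw [sq]

theorem inner_markovOp (h : p.Invariant π) (f g : Lp ℝ 2 π) :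
    inner ℝ f (markovOp p π h g) = ∫ z, f z.1 * g z.2 ∂(π ⊗ₘ p) := by
  rw [Measure.integral_compProd (integrable_mul_compProd h (Lp.memLp f) (Lp.memLp g)),
    inner_eq_integral_mul]
  refine integral_congr_ae ?_
  filter_upwards [markovOp_ae_eq p π h g] with x hx
  rw [hx, integral_const_mul]

/-- Reversibility on rectangles determines the finite measure `π ⊗ₘ p`; this symmetry makes `P`
symmetric. -/
theorem map_swap_compProd (h : p.IsReversible π) : (π ⊗ₘ p).map Prod.swap = π ⊗ₘ p := by
  have : IsFiniteMeasure ((π ⊗ₘ p).map Prod.swap) := Measure.isFiniteMeasure_map _ _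
  refine Measure.ext_prod fun {s t} hs ht => ?_
  rw [Measure.map_apply measurable_swap (hs.prod ht), Set.preimage_swap_prod,
    Measure.compProd_apply_prod ht hs, Measure.compProd_apply_prod hs ht]
  exact h ht hs

theorem isSymmetric_markovOp (h : p.IsReversible π) :
    (markovOp p π h.invariant : Lp ℝ 2 π →ₗ[ℝ] Lp ℝ 2 π).IsSymmetric := fun f g => by
  change inner ℝ (markovOp p π h.invariant f) g = inner ℝ f (markovOp p π h.invariant g)
  have hi := integrable_mul_compProd h.invariant (Lp.memLp f) (Lp.memLp g)
  rw [real_inner_comm, inner_markovOp, inner_markovOp]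
  conv_rhs => rw [← map_swap_compProd h]
  rw [integral_map measurable_swap.aemeasurable
    (by rw [map_swap_compProd h]; exact hi.aestronglyMeasurable)]
  simp [mul_comm]

theorem markovOp_comp (h : p.Invariant π) (f : Lp ℝ 2 π) :
    markovOp (p ∘ₖ p) π (h.comp h) f = markovOp p π h (markovOp p π h f) := by
  refine Lp.ext ?_
  filter_upwards [markovOp_ae_eq (p ∘ₖ p) π (h.comp h) f, markovOp_ae_eq p π h (markovOp p π h f),
    ae_ae h (markovOp_ae_eq p π h f), ae_integrable_kernel (h.comp h) (Lp.memLp f)]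
    with x h1 h2 h3 h4
  rw [h1, h2, integral_congr_ae h3, Kernel.integral_comp h4]

theorem inner_markovOp_comp (h : p.IsReversible π) (f g : Lp ℝ 2 π) :
    ∫ z, f z.1 * g z.2 ∂(π ⊗ₘ (p ∘ₖ p)) =
      inner ℝ (markovOp p π h.invariant f) (markovOp p π h.invariant g) := by
  rw [← inner_markovOp (h.invariant.comp h.invariant), markovOp_comp]
  exact (isSymmetric_markovOp h f (markovOp p π h.invariant g)).symm

/-- The Dirichlet form of the two-step kernel. -/
theorem integral_sub_sq_compProd_comp (h : p.IsReversible π) (f : Lp ℝ 2 π) :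
    ∫ z, (f z.1 - f z.2) ^ 2 ∂(π ⊗ₘ (p ∘ₖ p)) =
      2 * ‖f‖ ^ 2 - 2 * ‖markovOp p π h.invariant f‖ ^ 2 := by
  have h2 := h.invariant.comp h.invariant
  have m1 := measurePreserving_fst_compProd (p ∘ₖ p) π
  have m2 := measurePreserving_snd_compProd h2
  have hi := (Lp.memLp f).integrable_sq
  have hi1 : Integrable (fun z : Ω × Ω => f z.1 ^ 2) (π ⊗ₘ (p ∘ₖ p)) :=
    m1.integrable_comp_of_integrable hi
  have hi2 : Integrable (fun z : Ω × Ω => f z.2 ^ 2) (π ⊗ₘ (p ∘ₖ p)) :=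
    m2.integrable_comp_of_integrable hi
  have hi12 : Integrable (fun z : Ω × Ω => f z.1 ^ 2 + f z.2 ^ 2) (π ⊗ₘ (p ∘ₖ p)) := hi1.add hi2
  have hi3 : Integrable (fun z : Ω × Ω => 2 * (f z.1 * f z.2)) (π ⊗ₘ (p ∘ₖ p)) :=
    (integrable_mul_compProd h2 (Lp.memLp f) (Lp.memLp f)).const_mul 2
  have e1 : ∫ z, f z.1 ^ 2 ∂(π ⊗ₘ (p ∘ₖ p)) = ∫ x, f x ^ 2 ∂π :=
    integral_comp_measurePreserving m1 hi.aestronglyMeasurable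
  have e2 : ∫ z, f z.2 ^ 2 ∂(π ⊗ₘ (p ∘ₖ p)) = ∫ x, f x ^ 2 ∂π :=
    integral_comp_measurePreserving m2 hi.aestronglyMeasurable
  have hpt : ∀ z : Ω × Ω, (f z.1 - f z.2) ^ 2 = f z.1 ^ 2 + f z.2 ^ 2 - 2 * (f z.1 * f z.2) :=
    fun z => by ring
  simp_rw [hpt]
  rw [integral_sub hi12 hi3, integral_add hi1 hi2, integral_const_mul, inner_markovOp_comp h, e1,
    e2, ← norm_sq_eq_integral, real_inner_self_eq_norm_sq]
  ring

theorem lintegral_pow_two_compl {A : Set Ω} (hA : MeasurableSet A) :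
    ∫⁻ x in A, (p ^ 2) x Aᶜ ∂π = (π ⊗ₘ (p ∘ₖ p)) (A ×ˢ Aᶜ) := by
  rw [Measure.compProd_apply_prod hA hA.compl, pow_two]
  rfl

/-- The flow of the two-step kernel out of `A` in terms of the operator on `L²₀(π)`. -/
theorem exists_mem_meanZero_flow_eq (h : p.IsReversible π) {A : Set Ω}
    (hA : MeasurableSet A) : ∃ f : Lp ℝ 2 π, f ∈ meanZero π ∧ ‖f‖ ^ 2 = π.real A * π.real Aᶜ ∧
      (π ⊗ₘ (p ∘ₖ p)).real (A ×ˢ Aᶜ) =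
        π.real A * π.real Aᶜ - ‖markovOp p π h.invariant f‖ ^ 2 := by
  -- The test function is the centred indicator of `A`.
  have hmem : MemLp (fun x => A.indicator (fun _ => (1 : ℝ)) x - π.real A) 2 π :=
    (memLp_indicator_const 2 hA 1 (Or.inr (measure_ne_top _ _))).sub (memLp_const _)
  set a := π.real A with ha
  have hac : π.real Aᶜ = 1 - a := probReal_compl_eq_one_sub hA
  set F : Lp ℝ 2 π := hmem.toLp _
  have hfa : F =ᵐ[π] fun x => A.indicator (fun _ => (1 : ℝ)) x - a := hmem.coeFn_toLp
  have hint : Integrable (A.indicator fun _ => (1 : ℝ)) π := (integrable_const 1).indicator hA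
  have hIA : ∫ x, A.indicator (fun _ => (1 : ℝ)) x ∂π = a := integral_indicator_one hA
  refine ⟨F, ?_, ?_, ?_⟩
  · change ∫ x, F x ∂π = 0
    rw [integral_congr_ae hfa, integral_sub hint (integrable_const _), hIA]
    simp
  · rw [norm_sq_eq_integral, hac]
    have hpt : ∀ᵐ x ∂π, F x ^ 2 =
        (1 - 2 * a) * A.indicator (fun _ => (1 : ℝ)) x + a ^ 2 := by
      filter_upwards [hfa] with x hx
      rw [hx]
      by_cases hxA : x ∈ A <;> simp only [hxA, Set.indicator_of_mem, Set.indicator_of_notMem,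
        not_false_eq_true] <;> ring
    rw [integral_congr_ae hpt, integral_add (hint.const_mul _) (integrable_const _),
      integral_const_mul, hIA, integral_const, probReal_univ, one_smul]
    ring
  · have h2 := h.invariant.comp h.invariant
    have m1 := measurePreserving_fst_compProd (p ∘ₖ p) π
    have m2 := measurePreserving_snd_compProd h2
    set J := π ⊗ₘ (p ∘ₖ p) with hJ
    set B : Set (Ω × Ω) := A ×ˢ Aᶜ with hB
    have hBm : MeasurableSet B := hA.prod hA.compl
    have i1 : Integrable ((Prod.fst ⁻¹' A).indicator fun _ => (1 : ℝ)) J :=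
      (integrable_const 1).indicator (measurable_fst hA)
    have i2 : Integrable ((Prod.snd ⁻¹' A).indicator fun _ => (1 : ℝ)) J :=
      (integrable_const 1).indicator (measurable_snd hA)
    have i3 : Integrable (B.indicator fun _ => (1 : ℝ)) J := (integrable_const 1).indicator hBm
    have e1 : ∫ z, (Prod.fst ⁻¹' A).indicator (fun _ => (1 : ℝ)) z ∂J = a :=
      (integral_indicator_one (measurable_fst hA)).trans
        (m1.measureReal_preimage hA.nullMeasurableSet)
    have e2 : ∫ z, (Prod.snd ⁻¹' A).indicator (fun _ => (1 : ℝ)) z ∂J = a :=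
      (integral_indicator_one (measurable_snd hA)).trans
        (m2.measureReal_preimage hA.nullMeasurableSet)
    have e3 : ∫ z, B.indicator (fun _ => (1 : ℝ)) z ∂J = J.real B := integral_indicator_one hBm
    -- Expand the product of centred indicators, using `1_A(x) 1_A(y) = 1_A(x) - 1_B(x, y)`.
    have hpt : ∀ᵐ z ∂J, F z.1 * F z.2 =
        ((1 - a) * (Prod.fst ⁻¹' A).indicator (fun _ => (1 : ℝ)) z -
          a * (Prod.snd ⁻¹' A).indicator (fun _ => (1 : ℝ)) z) +
          (a ^ 2 - B.indicator (fun _ => (1 : ℝ)) z) := by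
      filter_upwards [m1.quasiMeasurePreserving.ae hfa, m2.quasiMeasurePreserving.ae hfa]
        with z hz1 hz2
      classical
      rw [hz1, hz2]
      by_cases h1A : z.1 ∈ A <;> by_cases h2A : z.2 ∈ A <;>
        simp only [Set.indicator_apply, hB, Set.mem_prod, Set.mem_compl_iff, Set.mem_preimage, h1A,
          h2A, if_true, if_false, not_true_eq_false, not_false_eq_true, and_true, and_false] <;>
        ring
    have key := inner_markovOp_comp h F F
    have j12 : Integrable (fun z => (1 - a) * (Prod.fst ⁻¹' A).indicator (fun _ => (1 : ℝ)) z -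
          a * (Prod.snd ⁻¹' A).indicator (fun _ => (1 : ℝ)) z) J :=
      (i1.const_mul _).sub (i2.const_mul _)
    have j3 : Integrable (fun z => a ^ 2 - B.indicator (fun _ => (1 : ℝ)) z) J :=
      (integrable_const _).sub i3
    rw [real_inner_self_eq_norm_sq, ← hJ, integral_congr_ae hpt, integral_add j12 j3,
      integral_sub (i1.const_mul _) (i2.const_mul _), integral_sub (integrable_const _) i3,
      integral_const_mul, integral_const_mul, e1, e2, e3, integral_const, probReal_univ,
      one_smul] at key
    rw [← key, hac]
    ring


theorem isSymmetric_markovOpZero (h : p.IsReversible π) :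
    (markovOpZero p π h.invariant : meanZero π →ₗ[ℝ] meanZero π).IsSymmetric :=
  fun f g => isSymmetric_markovOp h f g

/-- `L²₀(π)` is the orthogonal complement of the constants. Closedness gives the completeness needed
to bound the spectrum by the norm. -/
theorem isClosed_meanZero (π : Measure Ω) [IsProbabilityMeasure π] :
    IsClosed (meanZero π : Set (Lp ℝ 2 π)) := by
  have he : (meanZero π : Set (Lp ℝ 2 π)) = {f | inner ℝ (Lp.const 2 π (1 : ℝ)) f = 0} := by
    ext f
    change ∫ x, f x ∂π = 0 ↔ inner ℝ (Lp.const 2 π (1 : ℝ)) f = 0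
    rw [inner_eq_integral_mul]
    have : ∀ᵐ x ∂π, (Lp.const 2 π (1 : ℝ)) x * f x = f x := by
      filter_upwards [Lp.coeFn_const 2 π (1 : ℝ)] with x hx
      rw [hx]; simp
    rw [integral_congr_ae this]
  rw [he]
  exact isClosed_eq (by fun_prop) continuous_const

instance completeSpace_meanZero (π : Measure Ω) [IsProbabilityMeasure π] :
    CompleteSpace (meanZero π) := (isClosed_meanZero π).completeSpace_coe

theorem norm_pow_markovOp_apply_le (h : p.Invariant π) {f : Lp ℝ 2 π} (hf : f ∈ meanZero π)
    (n : ℕ) : ‖(markovOp p π h ^ n) f‖ ≤ ‖markovOpZero p π h‖ ^ n * ‖f‖ := by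
  suffices ∃ g : meanZero π, (g : Lp ℝ 2 π) = (markovOp p π h ^ n) f ∧
      ‖g‖ ≤ ‖markovOpZero p π h‖ ^ n * ‖f‖ by
    obtain ⟨g, hg, hn⟩ := this
    rw [← hg]
    exact hn
  induction n with
  | zero => exact ⟨⟨f, hf⟩, rfl, by simp⟩
  | succ n ih =>
    obtain ⟨g, hg, hn⟩ := ih
    refine ⟨markovOpZero p π h g, ?_, ?_⟩
    · rw [pow_succ', mul_apply_eq_comp, ← hg]
      rfl
    · calc ‖markovOpZero p π h g‖ ≤ ‖markovOpZero p π h‖ * ‖g‖ := ContinuousLinearMap.le_opNorm _ _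
        _ ≤ ‖markovOpZero p π h‖ * (‖markovOpZero p π h‖ ^ n * ‖f‖) := by gcongr
        _ = _ := by ring

theorem hasL2SpectralGap_iff (h : p.IsReversible π) :
    HasL2SpectralGap p π h.invariant ↔ ‖markovOpZero p π h.invariant‖ < 1 := by
  have hone : ∀ f : Lp ℝ 2 π, ∫ x, f x ^ 2 ∂π = 1 ↔ ‖f‖ = 1 := fun f => by
    rw [← norm_sq_eq_integral]
    exact pow_eq_one_iff_of_nonneg (norm_nonneg f) two_ne_zero
  constructor
  · rintro ⟨r, hr, hgap⟩
    -- The maximum covers `r > 1`, possible when `L²₀(π)` is trivial.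
    refine (ContinuousLinearMap.opNorm_le_of_unit_norm (C := max (1 - r) 0)
      (le_max_right _ _) fun f hf => ?_).trans_lt (max_lt (by linarith) one_pos)
    obtain ⟨l, hl, hlr⟩ := hgap f f.2 ((hone f).2 hf)
    exact (norm_apply_le_of_tendsto_norm_pow_root (isSymmetric_markovOp h) hf hl).trans
      (hlr.trans (le_max_left _ _))
  · intro hlt
    refine ⟨1 - ‖markovOpZero p π h.invariant‖, by linarith, fun f hf0 hf1 => ?_⟩
    rw [sub_sub_cancel]
    refine exists_tendsto_norm_pow_root (isSymmetric_markovOp h) ((hone f).1 hf1)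
      (ContinuousLinearMap.opNorm_nonneg _) fun n => ?_
    simpa [(hone f).1 hf1] using norm_pow_markovOp_apply_le h.invariant hf0 n

/-- Clearing the denominator extends the bound to sets of measure `0` or `1`, where the left side
vanishes; level sets can be such sets. -/
theorem isoConst_mul_le {k : ℝ≥0∞} (hk : k ≤ isoConst p π 2) {A : Set Ω} (hA : MeasurableSet A) :
    k * (π A * π Aᶜ) ≤ (π ⊗ₘ (p ∘ₖ p)) (A ×ˢ Aᶜ) := by
  rcases eq_or_ne (π A) 0 with h0 | h0
  · simp [h0]
  rcases eq_or_ne (π A) 1 with h1 | h1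
  · simp [(prob_compl_eq_zero_iff hA).2 h1]
  have hlt : π A < 1 := lt_of_le_of_ne prob_le_one h1
  rw [← lintegral_pow_two_compl hA]
  have hle : k ≤ isoFlow p π 2 A :=
    hk.trans (iInf₂_le_of_le A hA (iInf₂_le (pos_iff_ne_zero.2 h0) hlt))
  have hne : π A * π Aᶜ ≠ 0 := mul_ne_zero h0 fun hc => h1 ((prob_compl_eq_zero_iff hA).1 hc)
  exact (ENNReal.le_div_iff_mul_le (Or.inl hne)
    (Or.inl (ENNReal.mul_ne_top (measure_ne_top _ _) (measure_ne_top _ _)))).1 hle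

theorem isoConst_pos_of_norm_lt_one (h : p.IsReversible π)
    (hlt : ‖markovOpZero p π h.invariant‖ < 1) : 0 < isoConst p π 2 := by
  set c := ‖markovOpZero p π h.invariant‖ with hc
  have hc0 : 0 ≤ c := ContinuousLinearMap.opNorm_nonneg _
  have hc1 : 0 < 1 - c ^ 2 := by nlinarith
  refine (ENNReal.ofReal_pos.2 hc1).trans_le
    (le_iInf₂ fun A hA => le_iInf₂ fun h0 h1 => ?_)
  have hne : π A * π Aᶜ ≠ 0 :=
    mul_ne_zero h0.ne' fun hc => h1.ne ((prob_compl_eq_zero_iff hA).1 hc)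
  refine (ENNReal.le_div_iff_mul_le (Or.inl hne)
    (Or.inl (ENNReal.mul_ne_top (measure_ne_top _ _) (measure_ne_top _ _)))).2 ?_
  rw [lintegral_pow_two_compl hA]
  obtain ⟨f, hf, hfn, hflow⟩ := exists_mem_meanZero_flow_eq h hA
  have hPf : ‖markovOp p π h.invariant f‖ ≤ c * ‖f‖ := by
    simpa using norm_pow_markovOp_apply_le h.invariant hf 1
  have hPf2 : ‖markovOp p π h.invariant f‖ ^ 2 ≤ (c * ‖f‖) ^ 2 :=
    pow_le_pow_left₀ (norm_nonneg _) hPf 2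
  rw [mul_pow, hfn] at hPf2
  have hr : (1 - c ^ 2) * (π.real A * π.real Aᶜ) ≤ (π ⊗ₘ (p ∘ₖ p)).real (A ×ˢ Aᶜ) := by
    rw [hflow]; linarith
  rw [← ofReal_measureReal (μ := π) (s := A), ← ofReal_measureReal (μ := π) (s := Aᶜ),
    ← ofReal_measureReal (μ := π ⊗ₘ (p ∘ₖ p)) (s := A ×ˢ Aᶜ),
    ← ENNReal.ofReal_mul measureReal_nonneg, ← ENNReal.ofReal_mul hc1.le]
  exact ENNReal.ofReal_le_ofReal hr

theorem norm_lt_one_of_isoConst_pos (h : p.IsReversible π) (hpos : 0 < isoConst p π 2) :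
    ‖markovOpZero p π h.invariant‖ < 1 := by
  -- `isoConst` may be `∞`, so a finite positive `k` below it is used.
  obtain ⟨k, hk0, hk⟩ := ENNReal.lt_iff_exists_real_btwn.1 hpos
  have hk0' : 0 < k := ENNReal.ofReal_pos.1 hk.1
  -- Cheeger gives `k²/16 ‖f‖² ≤ 2‖f‖² - 2‖Pf‖²`, hence the factor `1 - k²/32`; the maximum with `0`
  -- keeps the square root meaningful.
  set d := max (1 - k ^ 2 / 32) 0 with hd
  have hd0 : 0 ≤ d := le_max_right _ _
  have hd1 : d < 1 := max_lt (by linarith [pow_pos hk0' 2]) one_pos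
  have hbound : ‖markovOpZero p π h.invariant‖ ≤ √d := by
    refine ContinuousLinearMap.opNorm_le_bound _ (Real.sqrt_nonneg _) fun f => ?_
    have hm := (Lp.stronglyMeasurable (f : Lp ℝ 2 π)).measurable
    have key := mul_integral_sq_le π (π ⊗ₘ (p ∘ₖ p)) (measurePreserving_fst_compProd _ π)
      (measurePreserving_snd_compProd (h.invariant.comp h.invariant)) hk0'
      (fun A hA => isoConst_mul_le hk.2.le hA) hm (Lp.memLp (f : Lp ℝ 2 π)) f.2
    rw [integral_sub_sq_compProd_comp h, ← norm_sq_eq_integral] at key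
    have hle : ‖markovOp p π h.invariant f‖ ^ 2 ≤ d * ‖(f : Lp ℝ 2 π)‖ ^ 2 := by
      have : (1 - k ^ 2 / 32) * ‖(f : Lp ℝ 2 π)‖ ^ 2 ≤ d * ‖(f : Lp ℝ 2 π)‖ ^ 2 :=
        mul_le_mul_of_nonneg_right (le_max_left _ _) (sq_nonneg _)
      linarith
    refine le_of_sq_le_sq ?_ (by positivity)
    rw [mul_pow, Real.sq_sqrt hd0]
    exact hle
  refine hbound.trans_lt ?_
  rw [Real.sqrt_lt' one_pos]
  simpa using hd1

end Kernel
end MarkovGap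

theorem mainTheorem3 {Ω : Type*} [MeasurableSpace Ω] (p : Kernel Ω Ω) [IsMarkovKernel p]
    (π : Measure Ω) [IsProbabilityMeasure π] (hrev : p.IsReversible π) :
    (MarkovGap.HasL2SpectralGap p π hrev.invariant ↔ 0 < MarkovGap.isoConst p π 2) ∧
    ((MarkovGap.HasGapAtOne p π hrev.invariant ∧ MarkovGap.HasGapAtNegOne p π hrev.invariant) ↔
      0 < MarkovGap.isoConst p π 2) := by
  have hiso : ‖MarkovGap.markovOpZero p π hrev.invariant‖ < 1 ↔ 0 < MarkovGap.isoConst p π 2 :=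
    ⟨MarkovGap.isoConst_pos_of_norm_lt_one hrev, MarkovGap.norm_lt_one_of_isoConst_pos hrev⟩
  exact ⟨(MarkovGap.hasL2SpectralGap_iff hrev).trans hiso,
    (MarkovGap.norm_lt_one_iff_spectrum (MarkovGap.isSymmetric_markovOpZero hrev)).symm.trans hiso⟩
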